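/- Let $H$ be a complex Hilbert space of finite dimension $D$. A *$\dagger$-special commutative Frobenius algebra* ($\dagger$-SCFA) on $H$ is a tuple $(\mu,\eta,\delta,\epsilon)$ of linear maps $\mu : H\otimes H\to H$, $\eta:\mathbb C\to H$, $\delta : H\to H\otimes H$, $\epsilon : H\to\mathbb C$ such that $(\mu,\eta)$ is a commutative monoid, $(\delta,\epsilon)$ is a comonoid, the Frobenius identities $(1\otimes\mu)(\delta\otimes 1)=\delta\mu=(\mu\otimes 1)(1\otimes\delta)$ hold, $\mu=\delta^\dagger$, $\eta=\epsilon^\dagger$ (Hilbert space adjoints), and $\mu\delta=1_H$. Two $\dagger$-SCFAs $O=(\mu,\eta,\delta,\epsilon)$ and $O'=(\mu',\eta',\delta',\epsilon')$ on $H$ are *strongly complementary* if they satisfy the scaled bialgebra equations: with $\sigma$ the swap map and $s=\epsilon'\circ\eta\in\mathbb C$, $$ s\,(\mu\otimes\mu)(1\otimes\sigma\otimes 1)(\delta'\otimes\delta')=\delta'\mu,\qquad s\,\delta'\eta=\eta\otimes\eta,\qquad s\,\epsilon'\mu=\epsilon'\otimes\epsilon' . $$ (This relation is symmetric in $O$ and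 $O'$.) **Theorem.** Suppose $D\ge 2$. 1. If $A$, $B$, $C$ are $\dagger$-SCFAs on $H$ such that $A$ is strongly complementary to $B$ and to $C$, then $B$ and $C$ are not strongly complementary. 2. Every set of $\dagger$-SCFAs on $H$ whose distinct members are pairwise strongly complementary has at most $2$ elements, and every such set that is maximal under inclusion has exactly $2$ elements. -/

import Mathlib

open scoped TensorProduct

/-- A `†`-special commutative Frobenius algebra on the finite-dimensional complex Hilbert space `H`
(an object of `FHilb`, with tensor unit `ℂ`): a commutative monoid `(μ, η)` and a comonoid `(δ, ε)`
on `H` satisfying the Frobenius identity, with `μ = δ†`, `η = ε†` and `μ ∘ δ = 1`.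
Here `†` is the Hilbert space adjoint, for the tensor product inner product on `H ⊗ H`. -/
@[ext]
structure DaggerSCFA (H : Type*) [NormedAddCommGroup H] [InnerProductSpace ℂ H]
    [FiniteDimensional ℂ H] where
  /-- the multiplication `μ` -/
  mul : H ⊗[ℂ] H →ₗ[ℂ] H
  /-- the unit `η` -/
  unit : ℂ →ₗ[ℂ] H
  /-- the comultiplication `δ` -/
  comul : H →ₗ[ℂ] H ⊗[ℂ] H
  /-- the counit `ε` -/
  counit : H →ₗ[ℂ] ℂ
  /-- `μ ∘ (μ ⊗ 1) = μ ∘ (1 ⊗ μ)` -/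
  mul_assoc : mul ∘ₗ mul.rTensor H =
    mul ∘ₗ mul.lTensor H ∘ₗ (TensorProduct.assoc ℂ H H H).toLinearMap
  /-- `μ ∘ (η ⊗ 1) = 1` -/
  unit_mul : mul ∘ₗ unit.rTensor H ∘ₗ (TensorProduct.lid ℂ H).symm.toLinearMap = LinearMap.id
  /-- `μ ∘ (1 ⊗ η) = 1` -/
  mul_unit : mul ∘ₗ unit.lTensor H ∘ₗ (TensorProduct.rid ℂ H).symm.toLinearMap = LinearMap.id
  /-- `μ ∘ σ = μ` -/
  mul_comm : mul ∘ₗ (TensorProduct.comm ℂ H H).toLinearMap = mul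
  /-- `(1 ⊗ δ) ∘ δ = (δ ⊗ 1) ∘ δ` -/
  comul_coassoc : (TensorProduct.assoc ℂ H H H).toLinearMap ∘ₗ comul.rTensor H ∘ₗ comul =
    comul.lTensor H ∘ₗ comul
  /-- `(ε ⊗ 1) ∘ δ = 1` -/
  counit_comul : (TensorProduct.lid ℂ H).toLinearMap ∘ₗ counit.rTensor H ∘ₗ comul = LinearMap.id
  /-- `(1 ⊗ ε) ∘ δ = 1` -/
  comul_counit : (TensorProduct.rid ℂ H).toLinearMap ∘ₗ counit.lTensor H ∘ₗ comul = LinearMap.id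
  /-- `(1 ⊗ μ) ∘ (δ ⊗ 1) = δ ∘ μ` -/
  frobenius_left : mul.lTensor H ∘ₗ (TensorProduct.assoc ℂ H H H).toLinearMap ∘ₗ comul.rTensor H =
    comul ∘ₗ mul
  /-- `(μ ⊗ 1) ∘ (1 ⊗ δ) = δ ∘ μ` -/
  frobenius_right :
    mul.rTensor H ∘ₗ (TensorProduct.assoc ℂ H H H).symm.toLinearMap ∘ₗ comul.lTensor H =
      comul ∘ₗ mul
  /-- `μ = δ†` -/
  mul_eq_adjoint : mul = LinearMap.adjoint comul
  /-- `η = ε†` -/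
  unit_eq_adjoint : unit = LinearMap.adjoint counit
  /-- `μ ∘ δ = 1` -/
  special : mul ∘ₗ comul = LinearMap.id

namespace DaggerSCFA

variable {H : Type*} [NormedAddCommGroup H] [InnerProductSpace ℂ H] [FiniteDimensional ℂ H]

/-- `O` and `O'` are strongly complementary: `(μ_O, η_O, δ_O', ε_O')` satisfies the scaled
bialgebra equations, where the scalar is the composite `s = ε_O' ∘ η_O`. (The scalar is not
a choice: composing each equation with units and counits shows that no other scalar can occur.
Taking adjoints shows that the relation is symmetric in `O` and `O'`.) -/
structure StronglyComplementary (O O' : DaggerSCFA H) : Prop where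
  /-- `s • (μ ⊗ μ) ∘ (1 ⊗ σ ⊗ 1) ∘ (δ' ⊗ δ') = δ' ∘ μ` -/
  bialgebra : O'.counit (O.unit 1) • (TensorProduct.map O.mul O.mul ∘ₗ
      (TensorProduct.tensorTensorTensorComm ℂ H H H H).toLinearMap ∘ₗ
        TensorProduct.map O'.comul O'.comul) = O'.comul ∘ₗ O.mul
  /-- `s • δ' ∘ η = η ⊗ η` -/
  copy_unit : O'.counit (O.unit 1) • (O'.comul ∘ₗ O.unit) =
    TensorProduct.map O.unit O.unit ∘ₗ (TensorProduct.lid ℂ ℂ).symm.toLinearMap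
  /-- `s • ε' ∘ μ = ε' ⊗ ε'` -/
  counit_mul : O'.counit (O.unit 1) • (O'.counit ∘ₗ O.mul) =
    (TensorProduct.lid ℂ ℂ).toLinearMap ∘ₗ TensorProduct.map O'.counit O'.counit

end DaggerSCFA

/-! Copyable states of a `†`-SCFA are orthonormal: `δ` is an isometry, so `z = ⟨x, y⟩` satisfies `z
= z²`. If `A` is strongly complementary to `B` and `C`, it copies multiples of `η_B` and `η_C`. Were
`B` and `C` strongly complementary, `⟨η_B, η_C⟩ ≠ 0` would make these multiples equal, so `C` would
copy its own unit up to a scalar; by Frobenius and the counit law this forces `D ≤ 1`.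

For exact size 2, every `A` needs a partner. Multiplications by elements commute and are closed
under adjoints, hence are jointly diagonalisable, and joint eigenvectors are multiples of copyable
states (`span_copyable`). So `A` copies an orthonormal basis; indexing it by `ZMod D` and taking the
normalised group algebra (`ofGroup`) gives the partner. -/

open ComplexConjugate

namespace DaggerSCFA

variable {H : Type*} [NormedAddCommGroup H] [InnerProductSpace ℂ H] [FiniteDimensional ℂ H]

/-! ### Copyable states and their orthonormality -/

section Basic

variable (A : DaggerSCFA H)

lemma inner_comul_left (x : H) (t : H ⊗[ℂ] H) :
    inner ℂ (A.comul x) t = inner ℂ x (A.mul t) := by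
  rw [A.mul_eq_adjoint, LinearMap.adjoint_inner_right]

lemma inner_comul_right (x : H) (t : H ⊗[ℂ] H) :
    inner ℂ t (A.comul x) = inner ℂ (A.mul t) x := by
  rw [A.mul_eq_adjoint, LinearMap.adjoint_inner_left]

lemma mul_comul (x : H) : A.mul (A.comul x) = x :=
  LinearMap.congr_fun A.special x

lemma inner_comul_comul (x y : H) :
    inner ℂ (A.comul x) (A.comul y) = inner ℂ x y := by
  rw [A.inner_comul_left, A.mul_comul]

lemma counit_eq_inner (x : H) : A.counit x = inner ℂ (A.unit 1) x := by
  rw [A.unit_eq_adjoint, LinearMap.adjoint_inner_left]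
  simp

lemma unit_mul_apply (x : H) : A.mul (A.unit 1 ⊗ₜ x) = x := by
  simpa using LinearMap.congr_fun A.unit_mul x

lemma mul_unit_apply (x : H) : A.mul (x ⊗ₜ A.unit 1) = x := by
  simpa using LinearMap.congr_fun A.mul_unit x

lemma mul_comm_apply (x y : H) : A.mul (x ⊗ₜ y) = A.mul (y ⊗ₜ x) := by
  simpa using (LinearMap.congr_fun A.mul_comm (y ⊗ₜ x))

lemma mul_assoc_apply (x y z : H) :
    A.mul (A.mul (x ⊗ₜ y) ⊗ₜ z) = A.mul (x ⊗ₜ A.mul (y ⊗ₜ z)) := by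
  simpa using LinearMap.congr_fun A.mul_assoc ((x ⊗ₜ y) ⊗ₜ z)

lemma comul_eq_lTensor (x : H) :
    A.comul x = A.mul.lTensor H (TensorProduct.assoc ℂ H H H (A.comul (A.unit 1) ⊗ₜ x)) := by
  simpa [A.unit_mul_apply] using (LinearMap.congr_fun A.frobenius_left (A.unit 1 ⊗ₜ x)).symm

lemma unit_ne_zero [Nontrivial H] : A.unit 1 ≠ 0 := by
  intro h
  obtain ⟨x, hx⟩ := exists_ne (0 : H)
  exact hx (by simpa [h] using (A.unit_mul_apply x).symm)

/-- On a space of dimension at least two, the unit is not proportional to a state copied by the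
comultiplication. -/
lemma comul_unit_ne_smul (hD : 2 ≤ Module.finrank ℂ H) (c : ℂ) :
    A.comul (A.unit 1) ≠ c • (A.unit 1 ⊗ₜ A.unit 1) := by
  intro h
  -- Frobenius determines `δ` from `δ η`, so here `δ x = c • η ⊗ x`; applying `1 ⊗ ε` gives `x` as a
  -- multiple of `η`.
  have key (x : H) : x = (c * A.counit x) • A.unit 1 := by
    have h1 := LinearMap.congr_fun A.comul_counit x
    have h2 : A.comul x = c • (A.unit 1 ⊗ₜ x) := by
      rw [A.comul_eq_lTensor, h]
      simp [← TensorProduct.smul_tmul', A.unit_mul_apply]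
    simpa [h2, smul_smul] using h1.symm
  have : Module.finrank ℂ H ≤ 1 :=
    finrank_le_one (A.unit 1) fun x => ⟨_, (key x).symm⟩
  omega

/-- The copyable states of a `†`-special commutative Frobenius algebra. -/
def copyable : Set H := {x | x ≠ 0 ∧ A.comul x = x ⊗ₜ x}

variable {A}

lemma inner_eq_sq_of_mem_copyable {x y : H} (hx : x ∈ A.copyable) (hy : y ∈ A.copyable) :
    inner ℂ x y = inner ℂ x y * inner ℂ x y := by
  rw [← TensorProduct.inner_tmul, ← hx.2, ← hy.2, A.inner_comul_comul]

lemma inner_self_of_mem_copyable {x : H} (hx : x ∈ A.copyable) : inner ℂ x x = (1 : ℂ) := by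
  have h := inner_eq_sq_of_mem_copyable hx hx
  have h0 : inner ℂ x x ≠ (0 : ℂ) := inner_self_ne_zero.2 hx.1
  exact (mul_left_cancel₀ h0 (by rw [mul_one]; exact h)).symm

/-- A nonzero solution of `z = z²` is 1, and two unit vectors with inner product 1 coincide, since
`‖x - y‖² = 0`. -/
lemma eq_of_inner_ne_zero {x y : H} (hx : x ∈ A.copyable) (hy : y ∈ A.copyable)
    (h : inner ℂ x y ≠ (0 : ℂ)) : x = y := by
  have hxy : inner ℂ x y = (1 : ℂ) :=
    (mul_left_cancel₀ h (by rw [mul_one]; exact inner_eq_sq_of_mem_copyable hx hy)).symm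
  have hyx : inner ℂ y x = (1 : ℂ) := by rw [← inner_conj_symm, hxy, map_one]
  rw [← sub_eq_zero, ← inner_self_eq_zero (𝕜 := ℂ), inner_sub_left, inner_sub_right,
    inner_sub_right, hxy, hyx, inner_self_of_mem_copyable hx, inner_self_of_mem_copyable hy]
  simp

lemma orthonormal_copyable : Orthonormal ℂ ((↑) : A.copyable → H) := by
  classical
  rw [orthonormal_iff_ite]
  intro x y
  split_ifs with h
  · subst h
    exact inner_self_of_mem_copyable x.2
  · by_contra h0
    exact h (Subtype.ext (eq_of_inner_ne_zero x.2 y.2 h0))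

lemma smul_mem_copyable {x : H} (hx : x ≠ 0) {c : ℂ} (hc : c ≠ 0)
    (h : A.comul x = c • (x ⊗ₜ x)) : c • x ∈ A.copyable := by
  refine ⟨smul_ne_zero hc hx, ?_⟩
  rw [map_smul, h, TensorProduct.smul_tmul_smul, smul_smul]

end Basic

/-! ### No pairwise strongly complementary triple -/

namespace StronglyComplementary

variable {A B C : DaggerSCFA H}

lemma smul_comul_unit_left (h : A.StronglyComplementary B) :
    B.counit (A.unit 1) • B.comul (A.unit 1) = A.unit 1 ⊗ₜ A.unit 1 := by
  simpa using LinearMap.congr_fun h.copy_unit 1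

/-- This is the adjoint of the law `s • ε' ∘ μ = ε' ⊗ ε'`, tested against pure tensors; the scalar
becomes `conj s`. -/
lemma smul_comul_unit_right (h : A.StronglyComplementary B) :
    A.counit (B.unit 1) • A.comul (B.unit 1) = B.unit 1 ⊗ₜ B.unit 1 := by
  rw [TensorProduct.ext_iff_inner_right]
  intro x y
  have := LinearMap.congr_fun h.counit_mul (x ⊗ₜ y)
  simp only [LinearMap.smul_apply, LinearMap.comp_apply, TensorProduct.map_tmul,
    LinearEquiv.coe_coe, TensorProduct.lid_tmul, smul_eq_mul, counit_eq_inner] at this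
  rw [inner_smul_left, A.inner_comul_left, TensorProduct.inner_tmul, ← this, A.counit_eq_inner,
    inner_conj_symm]

lemma counit_unit_left_ne_zero [Nontrivial H] (h : A.StronglyComplementary B) :
    B.counit (A.unit 1) ≠ 0 := by
  intro h0
  have := congrArg (fun t => inner ℂ t t) h.smul_comul_unit_left
  simp [h0, A.unit_ne_zero] at this

lemma counit_unit_right_ne_zero [Nontrivial H] (h : A.StronglyComplementary B) :
    A.counit (B.unit 1) ≠ 0 := by
  rw [A.counit_eq_inner, ← inner_conj_symm, ← B.counit_eq_inner]
  simpa using h.counit_unit_left_ne_zero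

/-- If `A` is strongly complementary to `B`, then `A` copies a multiple of the unit of `B`. -/
lemma inv_smul_unit_mem_copyable [Nontrivial H] (h : A.StronglyComplementary B) :
    (A.counit (B.unit 1))⁻¹ • B.unit 1 ∈ A.copyable :=
  smul_mem_copyable B.unit_ne_zero (inv_ne_zero h.counit_unit_right_ne_zero) <| by
    rw [← h.smul_comul_unit_right, inv_smul_smul₀ h.counit_unit_right_ne_zero]

/-- There is no triple of pairwise strongly complementary algebras. -/
theorem not_stronglyComplementary (hD : 2 ≤ Module.finrank ℂ H)
    (hB : A.StronglyComplementary B) (hC : A.StronglyComplementary C) :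
    ¬ B.StronglyComplementary C := by
  intro hBC
  have : Nontrivial H := Module.nontrivial_of_finrank_pos (R := ℂ) (by omega)
  have hb := hB.counit_unit_right_ne_zero
  have hc := hC.counit_unit_right_ne_zero
  have hbc := hBC.counit_unit_left_ne_zero
  have hcb := hBC.counit_unit_right_ne_zero
  -- The overlap is a nonzero multiple of `⟨η_B, η_C⟩ = ε_B (η_C)`.
  have hEq := eq_of_inner_ne_zero hB.inv_smul_unit_mem_copyable hC.inv_smul_unit_mem_copyable (by
    rw [inner_smul_left, inner_smul_right, ← B.counit_eq_inner]
    simp [hb, hc, hcb])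
  obtain ⟨t, ht, htB⟩ : ∃ t : ℂ, t ≠ 0 ∧ B.unit 1 = t • C.unit 1 := by
    refine ⟨A.counit (B.unit 1) * (A.counit (C.unit 1))⁻¹, mul_ne_zero hb (inv_ne_zero hc), ?_⟩
    rw [mul_smul, ← hEq, smul_inv_smul₀ hb]
  have h := hBC.smul_comul_unit_left
  set s := C.counit (B.unit 1)
  rw [htB, map_smul, TensorProduct.smul_tmul_smul, smul_smul] at h
  refine C.comul_unit_ne_smul hD ((s * t)⁻¹ * (t * t)) ?_
  rw [mul_smul, ← h, inv_smul_smul₀ (mul_ne_zero hbc ht)]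

/-- Needed to separate an algebra from its partner, as `Set.Pairwise` ignores the diagonal. -/
lemma irrefl (hD : 2 ≤ Module.finrank ℂ H) : ¬ A.StronglyComplementary A := fun h =>
  not_stronglyComplementary hD h h h

end StronglyComplementary

/-! ### Copyable bases via joint diagonalisation -/

section Spectral

variable (A : DaggerSCFA H)

/-- Multiplication by `x` as a linear map. -/
def mulLeft (x : H) : H →ₗ[ℂ] H := A.mul ∘ₗ TensorProduct.mk ℂ H H x

@[simp] lemma mulLeft_apply (x y : H) : A.mulLeft x y = A.mul (x ⊗ₜ y) := rfl

lemma mulLeft_mul (x y : H) :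
    A.mulLeft (A.mul (x ⊗ₜ y)) = A.mulLeft x ∘ₗ A.mulLeft y := by
  ext z
  simp [A.mul_assoc_apply]

lemma commute_mulLeft (x y : H) : Commute (A.mulLeft x) (A.mulLeft y) := by
  change A.mulLeft x ∘ₗ A.mulLeft y = A.mulLeft y ∘ₗ A.mulLeft x
  rw [← mulLeft_mul, ← mulLeft_mul, mul_comm_apply]

/-- The adjoint of a multiplication operator is a multiplication operator. -/
lemma exists_adjoint_mulLeft_eq (x : H) : ∃ y, LinearMap.adjoint (A.mulLeft x) = A.mulLeft y := by
  -- Contraction of the first factor with `x`; the adjoint is multiplication by `(⟨x| ⊗ 1) (δ η)`,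
  -- by Frobenius.
  set f : H ⊗[ℂ] H →ₗ[ℂ] H :=
    (TensorProduct.lid ℂ H).toLinearMap ∘ₗ (innerₛₗ ℂ x).rTensor H with hf
  refine ⟨f (A.comul (A.unit 1)), ?_⟩
  have key (t : H ⊗[ℂ] H) (z w : H) :
      inner ℂ (x ⊗ₜ[ℂ] z) (A.mul.lTensor H (TensorProduct.assoc ℂ H H H (t ⊗ₜ w))) =
        inner ℂ z (A.mul (f t ⊗ₜ w)) := by
    induction t with
    | zero => simp
    | tmul a b => simp [hf, ← TensorProduct.smul_tmul']
    | add a b ha hb => simp only [TensorProduct.add_tmul, map_add, inner_add_right, ha, hb]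
  ext w
  refine ext_inner_left ℂ fun z => ?_
  rw [LinearMap.adjoint_inner_right, mulLeft_apply, ← A.inner_comul_right, A.comul_eq_lTensor w,
    key, mulLeft_apply]

/-- A joint eigenvector of all multiplication operators is a multiple of a copyable state. -/
lemma exists_smul_mem_copyable {v : H} (hv : v ≠ 0) {χ : H → ℂ}
    (h : ∀ x, A.mul (x ⊗ₜ v) = χ x • v) : ∃ c : ℂ, c ≠ 0 ∧ c • v ∈ A.copyable := by
  have hvv : inner ℂ v v ≠ (0 : ℂ) := inner_self_ne_zero.2 hv
  -- The adjoint is again a multiplication, so `v` is an eigenvector of it too; `z = v` identifies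
  -- the eigenvalue.
  have hinner (y z : H) : inner ℂ v (A.mul (y ⊗ₜ z)) = χ y * inner ℂ v z := by
    obtain ⟨w, hw⟩ := A.exists_adjoint_mulLeft_eq y
    have h1 (z : H) : inner ℂ v (A.mul (y ⊗ₜ z)) = conj (χ w) * inner ℂ v z := by
      rw [← mulLeft_apply, ← LinearMap.adjoint_inner_left, hw, mulLeft_apply, h, inner_smul_left]
    have h2 := h1 v
    rw [h, inner_smul_right] at h2
    rw [h1, mul_right_cancel₀ hvv h2]
  -- Commutativity evaluates `⟨v, v·y⟩` in two ways, so the character `χ` is a multiple of `⟨v, ·⟩`.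
  have hχ (y : H) : χ y = χ v * inner ℂ v y / inner ℂ v v := by
    have h1 := hinner v y
    rw [A.mul_comm_apply, hinner] at h1
    rw [eq_div_iff hvv, h1]
  have hcomul : A.comul v = conj (χ v / inner ℂ v v) • (v ⊗ₜ v) := by
    rw [TensorProduct.ext_iff_inner_right]
    intro y z
    rw [A.inner_comul_left, hinner, hχ, inner_smul_left, Complex.conj_conj,
      TensorProduct.inner_tmul]
    ring
  refine ⟨_, ?_, smul_mem_copyable hv ?_ hcomul⟩ <;>
  · intro h0
    apply hv
    rw [← A.mul_comul v, hcomul, h0, zero_smul, map_zero]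

/-- The copyable states span the space. -/
lemma span_copyable : Submodule.span ℂ A.copyable = ⊤ := by
  -- Joint diagonalisation applies to commuting symmetric operators, hence the passage to `L_x +
  -- L_x†`.
  set T : H → H →ₗ[ℂ] H := fun x => A.mulLeft x + LinearMap.adjoint (A.mulLeft x) with hT
  have hsymm (x : H) : (T x).IsSymmetric := by
    intro u v
    simp only [hT, LinearMap.add_apply, inner_add_left, inner_add_right,
      LinearMap.adjoint_inner_left, LinearMap.adjoint_inner_right]
    ring
  have hcomm (x y : H) : Commute (T x) (T y) := by
    obtain ⟨x', hx⟩ := A.exists_adjoint_mulLeft_eq x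
    obtain ⟨y', hy⟩ := A.exists_adjoint_mulLeft_eq y
    simp only [hT, hx, hy]
    exact ((A.commute_mulLeft _ _).add_right (A.commute_mulLeft _ _)).add_left
      ((A.commute_mulLeft _ _).add_right (A.commute_mulLeft _ _))
  rw [eq_top_iff, ← LinearMap.IsSymmetric.iSup_iInf_eq_top_of_commute hsymm
    fun x y _ => hcomm x y, iSup_le_iff]
  intro χ v hv
  rcases eq_or_ne v 0 with rfl | hv0
  · exact zero_mem _
  simp only [Submodule.mem_iInf, Module.End.mem_eigenspace_iff] at hv
  have hI (x : H) : A.mulLeft (Complex.I • x) = Complex.I • A.mulLeft x := by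
    ext y
    simp [← TensorProduct.smul_tmul']
  -- Since `T (i x) = i L_x - i L_x†`, one recovers `2 L_x = T x - i T (i x)`.
  have hmul (x : H) :
      A.mul (x ⊗ₜ v) = ((χ x - Complex.I * χ (Complex.I • x)) / 2) • v := by
    have h1 := hv x
    have h2 := hv (Complex.I • x)
    simp only [hT, hI, map_smulₛₗ, LinearMap.add_apply, LinearMap.smul_apply, mulLeft_apply,
      Complex.conj_I] at h1 h2
    rw [div_eq_inv_mul, mul_smul, sub_smul, mul_smul, ← h1, ← h2, eq_inv_smul_iff₀ two_ne_zero,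
      smul_add, smul_smul, smul_smul, mul_neg, Complex.I_mul_I]
    module
  obtain ⟨c, hc, hcv⟩ := A.exists_smul_mem_copyable hv0 hmul
  rw [← inv_smul_smul₀ hc v]
  exact Submodule.smul_mem _ _ (Submodule.subset_span hcv)

/-- Every `†`-special commutative Frobenius algebra copies an orthonormal basis, which may be
indexed by any type of the right cardinality. -/
theorem exists_orthonormalBasis_copyable {ι : Type*} [Fintype ι]
    (hι : Fintype.card ι = Module.finrank ℂ H) :
    ∃ b : OrthonormalBasis ι ℂ H, ∀ i, A.comul (b i) = b i ⊗ₜ b i := by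
  have hli : LinearIndependent ℂ ((↑) : A.copyable → H) := orthonormal_copyable.linearIndependent
  have : Fintype A.copyable := hli.setFinite.fintype
  let b₀ : OrthonormalBasis A.copyable ℂ H :=
    OrthonormalBasis.mk orthonormal_copyable (by simp [A.span_copyable])
  have hcard : Fintype.card A.copyable = Fintype.card ι := by
    rw [hι, Module.finrank_eq_card_basis b₀.toBasis]
  refine ⟨b₀.reindex (Fintype.equivOfCardEq hcard), fun i => ?_⟩
  simp only [OrthonormalBasis.reindex_apply, b₀, OrthonormalBasis.coe_mk]
  exact (Subtype.prop _ : _ ∈ A.copyable).2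

end Spectral

/-! ### Structure maps in a copied basis -/

section Diagonal

variable {ι : Type*} [Fintype ι] {A : DaggerSCFA H} {b : OrthonormalBasis ι ℂ H}

lemma counit_apply_of_comul (h : ∀ i, A.comul (b i) = b i ⊗ₜ b i) (i : ι) :
    A.counit (b i) = 1 := by
  have h1 := LinearMap.congr_fun A.counit_comul (b i)
  simp only [LinearMap.comp_apply, h, LinearMap.rTensor_tmul, LinearEquiv.coe_coe,
    TensorProduct.lid_tmul, LinearMap.id_apply] at h1
  exact smul_left_injective ℂ (b.orthonormal.ne_zero i) (by simpa using h1)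

lemma unit_eq_sum_of_comul (h : ∀ i, A.comul (b i) = b i ⊗ₜ b i) :
    A.unit 1 = ∑ i, b i := by
  rw [← b.sum_repr' (A.unit 1)]
  refine Finset.sum_congr rfl fun i _ => ?_
  rw [← inner_conj_symm, ← A.counit_eq_inner, counit_apply_of_comul h]
  simp

lemma mul_apply_of_comul [DecidableEq ι] (h : ∀ i, A.comul (b i) = b i ⊗ₜ b i) (i j : ι) :
    A.mul (b i ⊗ₜ b j) = if i = j then b i else 0 := by
  refine InnerProductSpace.ext_inner_left_basis b.toBasis fun k => ?_
  rw [b.coe_toBasis, ← A.inner_comul_left, h, TensorProduct.inner_tmul, b.inner_eq_ite,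
    b.inner_eq_ite]
  split_ifs <;> simp_all

end Diagonal

/-! ### The partner algebra from a finite abelian group -/

section GroupAlgebra

/-- The square root of the cardinality of a finite type. -/
noncomputable def sqrtCard (G : Type*) [Fintype G] : ℂ := (Real.sqrt (Fintype.card G) : ℝ)

lemma sqrtCard_mul_self (G : Type*) [Fintype G] :
    sqrtCard G * sqrtCard G = Fintype.card G := by
  rw [sqrtCard, ← Complex.ofReal_mul, Real.mul_self_sqrt (Nat.cast_nonneg _),
    Complex.ofReal_natCast]

lemma sqrtCard_ne_zero (G : Type*) [Fintype G] [Nonempty G] : sqrtCard G ≠ 0 := by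
  intro h
  have := sqrtCard_mul_self G
  rw [h, mul_zero] at this
  exact Fintype.card_ne_zero (α := G) (by exact_mod_cast this.symm)

@[simp] lemma conj_sqrtCard (G : Type*) [Fintype G] : conj (sqrtCard G) = sqrtCard G :=
  Complex.conj_ofReal _

section Operations

variable {H : Type*} [NormedAddCommGroup H] [InnerProductSpace ℂ H]
  {G : Type*} [AddCommGroup G] [Fintype G] (b : OrthonormalBasis G ℂ H)

/-- The normalised convolution product in an orthonormal basis indexed by a finite group. -/
noncomputable def groupMul : H ⊗[ℂ] H →ₗ[ℂ] H :=
  (b.toBasis.tensorProduct b.toBasis).constr ℂ fun p => (sqrtCard G)⁻¹ • b (p.1 + p.2)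

/-- The normalised convolution coproduct in an orthonormal basis indexed by a finite group. -/
noncomputable def groupComul : H →ₗ[ℂ] H ⊗[ℂ] H :=
  b.toBasis.constr ℂ fun g => (sqrtCard G)⁻¹ • ∑ p, b p ⊗ₜ[ℂ] b (g - p)

/-- The counit of `groupComul`. -/
noncomputable def groupCounit [DecidableEq G] : H →ₗ[ℂ] ℂ :=
  b.toBasis.constr ℂ fun g => if g = 0 then sqrtCard G else 0

/-- The unit of `groupMul`. -/
noncomputable def groupUnit : ℂ →ₗ[ℂ] H := LinearMap.toSpanSingleton ℂ H (sqrtCard G • b 0)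

@[simp] lemma groupMul_apply (g h : G) :
    groupMul b (b g ⊗ₜ b h) = (sqrtCard G)⁻¹ • b (g + h) := by
  simpa [groupMul, Module.Basis.tensorProduct_apply] using
    (b.toBasis.tensorProduct b.toBasis).constr_basis ℂ
      (fun p : G × G => (sqrtCard G)⁻¹ • b (p.1 + p.2)) (g, h)

@[simp] lemma groupComul_apply (g : G) :
    groupComul b (b g) = (sqrtCard G)⁻¹ • ∑ p, b p ⊗ₜ[ℂ] b (g - p) := by
  rw [groupComul, ← b.coe_toBasis, Module.Basis.constr_basis]

@[simp] lemma groupCounit_apply [DecidableEq G] (g : G) :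
    groupCounit b (b g) = if g = 0 then sqrtCard G else 0 := by
  rw [groupCounit, ← b.coe_toBasis, Module.Basis.constr_basis]

@[simp] lemma groupUnit_apply (c : ℂ) : groupUnit b c = c • sqrtCard G • b 0 := rfl

lemma ext_tensor {M ι : Type*} [AddCommMonoid M] [Module ℂ M] [Fintype ι]
    (b : OrthonormalBasis ι ℂ H) {f g : H ⊗[ℂ] H →ₗ[ℂ] M}
    (h : ∀ i j, f (b i ⊗ₜ b j) = g (b i ⊗ₜ b j)) : f = g :=
  (b.toBasis.tensorProduct b.toBasis).ext fun p => by
    simpa [Module.Basis.tensorProduct_apply'] using h p.1 p.2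

end Operations

variable {G : Type*} [AddCommGroup G] [Fintype G] [DecidableEq G] (b : OrthonormalBasis G ℂ H)

/-- The `†`-special commutative Frobenius algebra given by the normalised group algebra structure
of a finite abelian group on an orthonormal basis. -/
noncomputable def ofGroup : DaggerSCFA H where
  mul := groupMul b
  unit := groupUnit b
  comul := groupComul b
  counit := groupCounit b
  mul_assoc := by
    refine (((b.toBasis.tensorProduct b.toBasis).tensorProduct b.toBasis)).ext fun p => ?_
    simp [Module.Basis.tensorProduct_apply', ← TensorProduct.smul_tmul', add_assoc]
  unit_mul := b.toBasis.ext fun g => by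
    simp [← TensorProduct.smul_tmul', smul_smul, sqrtCard_ne_zero]
  mul_unit := b.toBasis.ext fun g => by
    simp [smul_smul, sqrtCard_ne_zero]
  mul_comm := ext_tensor b fun g h => by simp [add_comm]
  comul_coassoc := b.toBasis.ext fun g => by
    simp only [LinearMap.comp_apply, OrthonormalBasis.coe_toBasis, groupComul_apply, map_smul,
      map_sum, LinearMap.rTensor_tmul, LinearMap.lTensor_tmul, ← TensorProduct.smul_tmul',
      TensorProduct.tmul_smul, TensorProduct.sum_tmul, TensorProduct.tmul_sum, LinearEquiv.coe_coe,
      TensorProduct.assoc_tmul, ← Finset.smul_sum]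
    congr 2
    rw [Finset.sum_comm]
    refine Finset.sum_congr rfl fun p _ => ?_
    -- Both sides sum over triples of group elements with total `g`; only the middle index is
    -- shifted.
    refine Fintype.sum_equiv (Equiv.subRight p) _ _ fun q => ?_
    simp
  counit_comul := b.toBasis.ext fun g => by
    simp [ite_smul, smul_smul, sqrtCard_ne_zero]
  comul_counit := b.toBasis.ext fun g => by
    simp [ite_smul, smul_smul, sqrtCard_ne_zero, sub_eq_zero]
  frobenius_left := ext_tensor b fun g h => by
    simp [← TensorProduct.smul_tmul', TensorProduct.sum_tmul, Finset.smul_sum, sub_add_eq_add_sub]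
  frobenius_right := ext_tensor b fun g h => by
    simp only [LinearMap.comp_apply, groupComul_apply, groupMul_apply, map_smul,
      map_sum, LinearMap.rTensor_tmul, LinearMap.lTensor_tmul, ← TensorProduct.smul_tmul',
      TensorProduct.tmul_smul, TensorProduct.tmul_sum, LinearEquiv.coe_coe,
      TensorProduct.assoc_symm_tmul, ← Finset.smul_sum]
    congr 2
    exact Fintype.sum_equiv (Equiv.addLeft g) _ _ fun q => by simp
  mul_eq_adjoint := by
    refine (LinearMap.eq_adjoint_iff_basis (b.toBasis.tensorProduct b.toBasis) b.toBasis _ _).2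
      fun p k => ?_
    rw [Module.Basis.tensorProduct_apply', b.coe_toBasis, groupMul_apply, groupComul_apply,
      inner_smul_left, inner_smul_right (E := H ⊗[ℂ] H), inner_sum, map_inv₀, conj_sqrtCard]
    simp only [TensorProduct.inner_tmul, b.inner_eq_ite, ite_mul, one_mul, zero_mul,
      Finset.sum_ite_eq, Finset.mem_univ, if_true, eq_sub_iff_add_eq, add_comm]
  unit_eq_adjoint := by
    refine (LinearMap.eq_adjoint_iff_basis_right b.toBasis _ _).2 fun g c => ?_
    simp [inner_smul_left, b.inner_eq_ite, eq_comm, _root_.mul_comm]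
  -- Each of the `|G|` terms of `δ (b g)` contributes `|G|⁻¹ • b g`, which dictates the factor
  -- `1/√|G|`.
  special := b.toBasis.ext fun g => by
    simp [smul_smul, ← Nat.cast_smul_eq_nsmul ℂ, ← sqrtCard_mul_self, sqrtCard_ne_zero]

lemma stronglyComplementary_ofGroup {A : DaggerSCFA H} (h : ∀ g, A.comul (b g) = b g ⊗ₜ b g) :
    A.StronglyComplementary (ofGroup b) := by
  have hs : (ofGroup b).counit (A.unit 1) = sqrtCard G := by
    simp [ofGroup, unit_eq_sum_of_comul h]
  constructor
  · rw [hs]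
    refine ext_tensor b fun g k => ?_
    -- Idempotent products keep only `p = q`, and then the second factor survives exactly when `g =
    -- k`.
    have hterm (p q : G) : (if p = q then b p else 0) ⊗ₜ[ℂ]
        (if g - p = k - q then b (g - p) else 0) =
          if p = q then (if g = k then b p ⊗ₜ[ℂ] b (g - p) else 0) else 0 := by
      by_cases hpq : p = q <;> by_cases hgk : g = k <;> simp [hpq, hgk]
    simp only [ofGroup, LinearMap.smul_apply, LinearMap.comp_apply, TensorProduct.map_tmul,
      groupComul_apply, TensorProduct.smul_tmul_smul, map_smul, TensorProduct.sum_tmul,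
      TensorProduct.tmul_sum, map_sum, LinearEquiv.coe_coe,
      TensorProduct.tensorTensorTensorComm_tmul, mul_apply_of_comul h, hterm, smul_smul]
    rw [mul_inv_cancel_left₀ (sqrtCard_ne_zero G)]
    split_ifs <;> simp
  · rw [hs]
    ext
    simp only [ofGroup, LinearMap.smul_apply, LinearMap.comp_apply, unit_eq_sum_of_comul h,
      map_sum, groupComul_apply, ← Finset.smul_sum, LinearEquiv.coe_coe,
      TensorProduct.lid_symm_apply, TensorProduct.map_tmul, TensorProduct.sum_tmul,
      TensorProduct.tmul_sum]
    rw [smul_inv_smul₀ (sqrtCard_ne_zero G), Finset.sum_comm]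
    conv_rhs => rw [Finset.sum_comm]
    refine Finset.sum_congr rfl fun p _ => ?_
    exact Fintype.sum_equiv (Equiv.subRight p) _ _ fun q => rfl
  · rw [hs]
    refine ext_tensor b fun g k => ?_
    by_cases hgk : g = k
    · by_cases hk : k = 0 <;> simp [ofGroup, mul_apply_of_comul h, hgk, hk]
    · by_cases hk : k = 0 <;> simp_all [ofGroup, mul_apply_of_comul h]

/-- `A` copies each `b g` and group multiplication permutes these up to scale. Both orders are
checked because `Set.Pairwise` asks for both. -/
lemma ofGroup_stronglyComplementary {A : DaggerSCFA H} (h : ∀ g, A.comul (b g) = b g ⊗ₜ b g) :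
    (ofGroup b).StronglyComplementary A := by
  have hs : A.counit ((ofGroup b).unit 1) = sqrtCard G := by
    simp [ofGroup, counit_apply_of_comul h]
  constructor
  · rw [hs]
    refine ext_tensor b fun g k => ?_
    simp [ofGroup, ← TensorProduct.smul_tmul', h, sqrtCard_ne_zero]
  · rw [hs]
    ext
    simp [ofGroup, ← TensorProduct.smul_tmul', h]
  · rw [hs]
    refine ext_tensor b fun g k => ?_
    simp [ofGroup, counit_apply_of_comul h, sqrtCard_ne_zero]

end GroupAlgebra

end DaggerSCFA

theorem mainTheorem5 {H : Type*} [NormedAddCommGroup H] [InnerProductSpace ℂ H]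
    [FiniteDimensional ℂ H] (hD : 2 ≤ Module.finrank ℂ H) :
    (∀ A B C : DaggerSCFA H, A.StronglyComplementary B → A.StronglyComplementary C →
      ¬ B.StronglyComplementary C) ∧
    (∀ S : Set (DaggerSCFA H), S.Pairwise DaggerSCFA.StronglyComplementary → S.encard ≤ 2) ∧
    (∀ S : Set (DaggerSCFA H),
      Maximal (fun T : Set (DaggerSCFA H) => T.Pairwise DaggerSCFA.StronglyComplementary) S →
        S.encard = 2) := by
  have hle (S : Set (DaggerSCFA H)) (hS : S.Pairwise DaggerSCFA.StronglyComplementary) :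
      S.encard ≤ 2 := by
    by_contra! hcard
    obtain ⟨T, hTS, hT⟩ := Set.exists_subset_encard_eq (Order.add_one_le_of_lt hcard)
    obtain ⟨A, B, C, hAB, hAC, hBC, rfl⟩ := Set.encard_eq_three.1 (hT.trans (by norm_num))
    have hA : A ∈ S := hTS (by simp)
    have hB : B ∈ S := hTS (by simp)
    have hC : C ∈ S := hTS (by simp)
    exact (hS hA hB hAB).not_stronglyComplementary hD (hS hA hC hAC) (hS hB hC hBC)
  refine ⟨fun A B C hB hC => hB.not_stronglyComplementary hD hC, hle, fun S hS => ?_⟩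
  -- `ZMod 0` is `ℤ`, so finiteness of the index group needs a nonzero dimension.
  have : NeZero (Module.finrank ℂ H) := ⟨by omega⟩
  have hcard := ZMod.card (Module.finrank ℂ H)
  refine (hle S hS.prop).antisymm ?_
  rcases S.eq_empty_or_nonempty with rfl | ⟨A, hA⟩
  -- The empty set is not maximal: some algebra exists, and any singleton is vacuously pairwise.
  · let b := (stdOrthonormalBasis ℂ H).reindex
      (Fintype.equivOfCardEq (β := ZMod (Module.finrank ℂ H)) (by simp [hcard]))
    exact absurd (hS.le_of_ge (Set.pairwise_singleton (DaggerSCFA.ofGroup b) _)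
      (Set.empty_subset _) rfl) (Set.notMem_empty _)
  · obtain ⟨b, hb⟩ := A.exists_orthonormalBasis_copyable hcard
    have h1 := DaggerSCFA.stronglyComplementary_ofGroup b hb
    have h2 := DaggerSCFA.ofGroup_stronglyComplementary b hb
    have hne : A ≠ DaggerSCFA.ofGroup b := fun h =>
      DaggerSCFA.StronglyComplementary.irrefl hD (h ▸ h1 : A.StronglyComplementary A)
    by_contra! hlt
    -- A nonempty set with fewer than two members is `{A}`, which adjoining the partner of `A`
    -- strictly enlarges.
    have hS1 : S = {A} := by
      obtain ⟨B, rfl⟩ := Set.encard_eq_one.1 <| le_antisymm (ENat.lt_add_one_iff (by simp) |>.1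
        (by simpa [one_add_one_eq_two] using hlt)) (Set.one_le_encard_iff_nonempty.2 ⟨A, hA⟩)
      rw [Set.mem_singleton_iff.1 hA]
    subst hS1
    have hmem := hS.le_of_ge (y := {A, DaggerSCFA.ofGroup b})
      (by rw [Set.pairwise_pair]; exact fun _ => ⟨h1, h2⟩) (by simp)
      (Set.mem_insert_of_mem _ rfl)
    exact hne (Set.mem_singleton_iff.1 hmem).symm
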